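/- Let $d\ge 1$, $N\ge 1$ and $\nu\ge 1$ be integers. Let $R\subset\mathbb{R}^d$ be a measurable set containing $\mathbf 0$ in its interior and let $f,g:R\to\mathbb{R}$ be measurable. Suppose that $f(\mathbf 0)=0$, that $f>0$ on $R\setminus\{\mathbf 0\}$, and that for every $\delta>0$ there is $A>0$ with $f(\mathbf x)\ge A$ for all $\mathbf x\in R$ with $|\mathbf x|\ge\delta$. Suppose that $f$ and $g$ are given by finite Taylor expansions with remainder: as $\mathbf x\to\mathbf 0$, $$f(\mathbf x)=\sum_{\nu\le|\alpha|\le N+\nu}\frac{D^\alpha f(\mathbf 0)}{\alpha!}\,\mathbf x^\alpha+O(|\mathbf x|^{N+\nu+1}),\qquad g(\mathbf x)=\sum_{0\le|\beta|\le N}\frac{D^\beta g(\mathbf 0)}{\beta!}\,\mathbf x^\beta+O(|\mathbf x|^{N+1}),$$ where $\alpha=(\alpha^1,\dots,\alpha^d)$ and $\beta$ are multi-indices and $D^\alpha=\partial_1^{\alpha^1}\cdots\partial_d^{\alpha^d}$. Suppose that there is a constant $f_0>0$ with $$\sum_{|\alpha|=\nu}\frac{D^\alpha f(\mathbf 0)}{\alpha!}\,\Omega^\alpha=f_0\qquad\text{for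 all }\Omega\in S^{d-1}=\{\Omega\in\mathbb{R}^d:|\Omega|=1\}.$$ Suppose finally that for some $k_0>0$ the integral $\int_R e^{-k_0f}g\,d^d\mathbf x$ converges absolutely. Then $\int_R e^{-kf}g\,d^d\mathbf x$ converges absolutely for all $k\ge k_0$, and $$\int_R e^{-kf}g\,d^d\mathbf x=k^{-d/\nu}\sum_{j=0}^N\zeta_j\,k^{-j/\nu}+O\!\left(k^{-(N+d+1)/\nu}\right),\qquad k\to\infty,$$ where $$\zeta_j=\tfrac1\nu\,\Gamma\!\left(\tfrac{d+j}{\nu}\right)f_0^{-(j+d)/\nu}\sum_{m=0}^{j}A_{j,m},\qquad A_{j,0}=\sum_{|\beta|=j}w_\beta\,\frac{D^\beta g(\mathbf 0)}{\beta!},$$ and, for $1\le m\le j$, $$A_{j,m}=\sum_{r=1}^{m}\binom{-\frac{d+j}{\nu}}{r}f_0^{-r}\sum_{|\beta|=j-m}\ \sum_{\substack{n_1+\cdots+n_r=m\\ n_i\ge1}}\ \sum_{|\alpha_1|=n_1+\nu}\cdots\sum_{|\alpha_r|=n_r+\nu}w_{\beta+\alpha_1+\cdots+\alpha_r}\,\frac{D^\beta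 g(\mathbf 0)\,D^{\alpha_1}f(\mathbf 0)\cdots D^{\alpha_r}f(\mathbf 0)}{\beta!\,\alpha_1!\cdots\alpha_r!}.$$ Here $\binom{a}{r}=a(a-1)\cdots(a-r+1)/r!$, and for a multi-index $\alpha$ $$w_\alpha=(2\pi)^{d/2}\,c_d\,\frac{\prod_{i=1}^d(\alpha^i-1)!!}{(|\alpha|+d-2)!!}\,\operatorname{even}(\alpha),\qquad c_d=\begin{cases}1,&d\text{ even},\\ \sqrt{2/\pi},&d\text{ odd},\end{cases}$$ where $\operatorname{even}(\alpha)=1$ if all components of $\alpha$ are even and $\operatorname{even}(\alpha)=0$ otherwise, and $(-1)!!=0!!=1$. -/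

import Mathlib

open MeasureTheory Filter Topology Asymptotics

namespace LaplaceTaylor

noncomputable section

/-- The (finite) set of multi-indices `α = (α¹, …, αᵈ)` of order `|α| = n`. -/
def multiIndices (d n : ℕ) : Finset (Fin d → ℕ) :=
  Finset.piAntidiag Finset.univ n

/-- `α! = α¹! ⋯ αᵈ!`. -/
def multiFactorial {d : ℕ} (α : Fin d → ℕ) : ℕ :=
  ∏ i, (α i).factorial

/-- The monomial `x^α = (x¹)^{α¹} ⋯ (xᵈ)^{αᵈ}`. -/
def monomial {d : ℕ} (α : Fin d → ℕ) (x : EuclideanSpace ℝ (Fin d)) : ℝ :=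
  ∏ i, x i ^ α i

/-- The partial derivative `∂u/∂xⁱ`. -/
def partialDeriv {d : ℕ} (i : Fin d) (u : EuclideanSpace ℝ (Fin d) → ℝ) :
    EuclideanSpace ℝ (Fin d) → ℝ :=
  fun x => lineDeriv ℝ u x (EuclideanSpace.single i 1)

/-- The mixed partial derivative `D^α u = ∂₁^{α¹} ∂₂^{α²} ⋯ ∂_d^{αᵈ} u`. -/
def mixedDeriv {d : ℕ} (α : Fin d → ℕ) (u : EuclideanSpace ℝ (Fin d) → ℝ) :
    EuclideanSpace ℝ (Fin d) → ℝ :=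
  (List.finRange d).foldr (fun i v => (partialDeriv i)^[α i] v) u

/-- The homogeneous part of degree `n` of the Taylor expansion of `u` at the origin,
`∑_{|α| = n} D^α u(0) x^α / α!`. -/
def taylorPart {d : ℕ} (u : EuclideanSpace ℝ (Fin d) → ℝ) (n : ℕ)
    (x : EuclideanSpace ℝ (Fin d)) : ℝ :=
  ∑ α ∈ multiIndices d n, mixedDeriv α u 0 / (multiFactorial α : ℝ) * monomial α x

/-- `u` is given near the origin by its Taylor series with remainder, with terms of orders
`a, a + 1, …, b`:  `u(x) = ∑_{a ≤ |α| ≤ b} D^α u(0) x^α / α! + O(|x|^{b+1})` as `x → 0`. -/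
def HasTaylorExpansion {d : ℕ} (u : EuclideanSpace ℝ (Fin d) → ℝ) (a b : ℕ) : Prop :=
  (fun x => u x - ∑ n ∈ Finset.Icc a b, taylorPart u n x) =O[𝓝 0] fun x => ‖x‖ ^ (b + 1)

/-- `even(α)` is `1` if all components of `α` are even and `0` otherwise. -/
def evenIndicator {d : ℕ} (α : Fin d → ℕ) : ℝ :=
  if ∀ i, Even (α i) then 1 else 0

/-- The double factorial `n‼` of an integer `n ≥ -1`, with `(-1)‼ = 0‼ = 1`.
(Smaller integers do not occur; they get the value `1`.) -/
def doubleFact (n : ℤ) : ℝ :=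
  (Nat.doubleFactorial n.toNat : ℝ)

/-- The weight
`w_α = (2π)^{d/2} · {1 if d even, √(2/π) if d odd} · (α - 𝟏)‼ / (|α| + d - 2)‼ · even(α)`. -/
def weight {d : ℕ} (α : Fin d → ℕ) : ℝ :=
  (2 * Real.pi) ^ ((d : ℝ) / 2) * (if Even d then 1 else Real.sqrt (2 / Real.pi)) *
    ((∏ i, doubleFact ((α i : ℤ) - 1)) / doubleFact ((∑ i, (α i : ℤ)) + (d : ℤ) - 2)) *
    evenIndicator α

/-- The tuples `(n₁, …, n_r)` of integers `nᵢ ≥ 1` with `n₁ + ⋯ + n_r = m`. -/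
def orderedPartitions (r m : ℕ) : Finset (Fin r → ℕ) :=
  (Finset.piAntidiag Finset.univ m).filter fun n => ∀ i, 1 ≤ n i

/-- The sum
`∑_{|β| = l} ∑_{n₁ + ⋯ + n_r = m, nᵢ ≥ 1} ∑_{|α₁| = n₁ + ν} ⋯ ∑_{|α_r| = n_r + ν}
  w_{β + α₁ + ⋯ + α_r} D^β g(0) D^{α₁} f(0) ⋯ D^{α_r} f(0) / (β! α₁! ⋯ α_r!)`. -/
def innerSum {d : ℕ} (f g : EuclideanSpace ℝ (Fin d) → ℝ) (ν l m r : ℕ) : ℝ :=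
  ∑ β ∈ multiIndices d l, ∑ n ∈ orderedPartitions r m,
    ∑ α ∈ Fintype.piFinset fun i : Fin r => multiIndices d (n i + ν),
      weight (β + ∑ i, α i) *
        ((mixedDeriv β g 0 * ∏ i, mixedDeriv (α i) f 0) /
          ((multiFactorial β : ℝ) * ∏ i, (multiFactorial (α i) : ℝ)))

/-- The coefficient `ζ_j`.  For `m = 0` the sum over `1 ≤ r ≤ m` is empty; by the convention on
empty sums the factors carrying `f` are then `1`, and what remains is
`∑_{|β| = j} w_β D^β g(0) / β!`. -/
def zeta {d : ℕ} (f g : EuclideanSpace ℝ (Fin d) → ℝ) (ν : ℕ) (f₀ : ℝ) (j : ℕ) : ℝ :=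
  1 / (ν : ℝ) * Real.Gamma (((d : ℝ) + j) / ν) * f₀ ^ (-(((j : ℝ) + d) / ν)) *
    ∑ m ∈ Finset.range (j + 1),
      if m = 0 then
        ∑ β ∈ multiIndices d j, weight β * (mixedDeriv β g 0 / (multiFactorial β : ℝ))
      else
        ∑ r ∈ Finset.Icc 1 m,
          Ring.choose (-(((d : ℝ) + j) / ν)) r * (f₀ ^ r)⁻¹ * innerSum f g ν (j - m) m r

end

end LaplaceTaylor

namespace LaplaceTaylor

/-! Write `f = f₀ ‖x‖ ^ ν + Φ` with `Φ = O(‖x‖ ^ (ν + 1))` near the origin. Then `e^{-kf} = e^{-k f₀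
‖x‖ ^ ν} e^{-kΦ}`; expand the second factor in powers of `kΦ` up to order `N` and insert the Taylor
expansions of `Φ` and `g`. A monomial of degree `rν + j` in `Φ ^ r g` comes with the factor `k ^ r`,
and the scaling `x ↦ k ^ (-1/ν) x` shows that it integrates to a multiple of `k ^ (-(d + j)/ν)`,
whatever `r` is. Hence `j` grades the expansion, and terms of relative order `N + 1` give the error.

Since the leading part of `f` is radial, each moment splits into a sphere moment, which is `weight`
by `integral_sphere_monomial`, and a radial Gamma integral. `choose_neg_mul_Gamma` turns the factors
`(-1) ^ r / r! · Γ(s + r)` into binomial coefficients, and `sum_innerSum_eq_zeta` collects them into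
`zeta`.

The main terms are integrated over all of space, where the formulas are exact. One majorant controls
both the expansion error in a small ball (`abs_exp_mul_sub_sum_le`) and the main terms outside it
(`exists_abs_truncatedProduct_le`). The part of `R` outside the ball is exponentially small. -/

/-! ### Multi-indices and monomials. -/

lemma mem_multiIndices {d n : ℕ} {α : Fin d → ℕ} : α ∈ multiIndices d n ↔ ∑ i, α i = n := by
  simp [multiIndices]

lemma monomial_smul {d : ℕ} (α : Fin d → ℕ) (t : ℝ) (x : EuclideanSpace ℝ (Fin d)) :
    monomial α (t • x) = t ^ (∑ i, α i) * monomial α x := by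
  simp [monomial, mul_pow, Finset.prod_mul_distrib, Finset.prod_pow_eq_pow_sum]

lemma abs_monomial_le {d : ℕ} (α : Fin d → ℕ) (x : EuclideanSpace ℝ (Fin d)) :
    |monomial α x| ≤ ‖x‖ ^ (∑ i, α i) := by
  rw [monomial, Finset.abs_prod, ← Finset.prod_pow_eq_pow_sum]
  refine Finset.prod_le_prod (fun _ _ => abs_nonneg _) fun i _ => ?_
  rw [abs_pow]
  exact pow_le_pow_left₀ (abs_nonneg _) (PiLp.norm_apply_le x i) _

lemma continuous_monomial {d : ℕ} (α : Fin d → ℕ) : Continuous (monomial α) := by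
  unfold monomial
  fun_prop

lemma monomial_add_sum {d r : ℕ} (β : Fin d → ℕ) (α : Fin r → Fin d → ℕ)
    (x : EuclideanSpace ℝ (Fin d)) :
    monomial (β + ∑ i, α i) x = monomial β x * ∏ i, monomial (α i) x := by
  simp only [monomial, Pi.add_apply, Finset.sum_apply, pow_add, Finset.prod_mul_distrib,
    ← Finset.prod_pow_eq_pow_sum]
  rw [Finset.prod_comm]

/-! ### Polar coordinates, sphere moments and radial Gamma integrals. -/

/-- In polar coordinates `x = rω` homogeneity gives `φ x = r ^ n φ ω`, so the integrand is a
product. The product formula for integrals needs no integrability, so `F` is arbitrary. -/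
lemma integral_homogeneous_mul_radial {d : ℕ} (hd : 1 ≤ d) {φ : EuclideanSpace ℝ (Fin d) → ℝ}
    {n : ℕ} (hφ : ∀ (t : ℝ) x, φ (t • x) = t ^ n * φ x) (F : ℝ → ℝ) :
    ∫ x, φ x * F ‖x‖ =
      (∫ ω : Metric.sphere (0 : EuclideanSpace ℝ (Fin d)) 1, φ ω ∂(volume.toSphere)) *
        ∫ r in Set.Ioi (0 : ℝ), r ^ (n + d - 1) * F r := by
  have : NeZero d := ⟨by omega⟩
  set μ : Measure (EuclideanSpace ℝ (Fin d)) := volume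
  calc
    ∫ x, φ x * F ‖x‖ ∂μ
        = ∫ x : ({(0)}ᶜ : Set (EuclideanSpace ℝ (Fin d))), φ x.1 * F ‖x.1‖ ∂(μ.comap (↑)) := by
      rw [integral_subtype_comap (measurableSet_singleton _).compl fun x ↦ φ x * F ‖x‖,
        restrict_compl_singleton]
    _ = ∫ x : ({(0)}ᶜ : Set (EuclideanSpace ℝ (Fin d))),
          φ (homeomorphUnitSphereProd _ x).1 *
            ((homeomorphUnitSphereProd _ x).2.1 ^ n * F (homeomorphUnitSphereProd _ x).2)
            ∂(μ.comap (↑)) := by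
      congr 1 with x
      have hx : ‖x.1‖ ≠ 0 := norm_ne_zero_iff.2 x.2
      simp only [homeomorphUnitSphereProd_apply_fst_coe, homeomorphUnitSphereProd_apply_snd_coe]
      rw [hφ, inv_pow]
      field_simp
    _ = ∫ x : Metric.sphere (0 : EuclideanSpace ℝ (Fin d)) 1 × Set.Ioi (0 : ℝ),
          φ x.1 * (x.2.1 ^ n * F x.2) ∂μ.toSphere.prod (.volumeIoiPow (d - 1)) := by
      have h := μ.measurePreserving_homeomorphUnitSphereProd.integral_comp
        (Homeomorph.measurableEmbedding _)
        (fun x : Metric.sphere (0 : EuclideanSpace ℝ (Fin d)) 1 × Set.Ioi (0 : ℝ) =>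
          φ x.1 * (x.2.1 ^ n * F x.2))
      simpa using h
    _ = (∫ ω : Metric.sphere (0 : EuclideanSpace ℝ (Fin d)) 1, φ ω ∂μ.toSphere) *
          ∫ x : Set.Ioi (0 : ℝ), x.1 ^ n * F x ∂.volumeIoiPow (d - 1) :=
      integral_prod_mul (fun ω : Metric.sphere (0 : EuclideanSpace ℝ (Fin d)) 1 => φ ω)
        (fun x : Set.Ioi (0 : ℝ) => x.1 ^ n * F x)
    _ = _ := by
      congr 1
      simp only [Measure.volumeIoiPow, ENNReal.ofReal]
      rw [integral_withDensity_eq_integral_smul, ← integral_subtype_comap measurableSet_Ioi]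
      · congr 1 with x
        have hx : (0 : ℝ) < x.1 := x.2
        rw [NNReal.smul_def, Real.coe_toNNReal _ (pow_nonneg hx.le _), smul_eq_mul, ← mul_assoc,
          ← pow_add]
        congr 2
        omega
      · exact (measurable_subtype_coe.pow_const _).real_toNNReal

lemma integral_Ioi_pow_mul_exp (m : ℕ) {p : ℕ} (hp : 1 ≤ p) {b : ℝ} (hb : 0 < b) :
    ∫ r in Set.Ioi (0 : ℝ), r ^ m * Real.exp (-(b * r ^ p)) =
      1 / p * Real.Gamma (((m : ℝ) + 1) / p) * b ^ (-(((m : ℝ) + 1) / p)) := by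
  have hp' : (0 : ℝ) < p := by exact_mod_cast hp
  have h := integral_rpow_mul_exp_neg_mul_rpow hp' (q := m)
    (by have : (0 : ℝ) ≤ m := by positivity
        linarith) hb
  simp only [Real.rpow_natCast, neg_mul] at h
  rw [h, neg_div]
  ring

lemma integrableOn_Ioi_pow_mul_exp (m : ℕ) {p : ℕ} (hp : 1 ≤ p) {b : ℝ} (hb : 0 < b) :
    IntegrableOn (fun r : ℝ => r ^ m * Real.exp (-(b * r ^ p))) (Set.Ioi 0) := by
  have hp' : (0 : ℝ) < p := by exact_mod_cast hp
  have h := integrableOn_rpow_mul_exp_neg_mul_rpow (s := m)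
    (by have : (0 : ℝ) ≤ m := by positivity
        linarith) hp' hb
  simpa only [Real.rpow_natCast, neg_mul] using h

lemma integral_pow_mul_exp_neg_sq (a : ℕ) :
    ∫ x : ℝ, x ^ a * Real.exp (-x ^ 2) =
      if Even a then Real.Gamma (((a : ℝ) + 1) / 2) else 0 := by
  split_ifs with ha
  · have h := integral_comp_abs (f := fun x : ℝ => x ^ a * Real.exp (-x ^ 2))
    simp only [ha.pow_abs, sq_abs] at h
    have h2 := integral_Ioi_pow_mul_exp a one_le_two one_pos
    simp only [one_mul, Real.one_rpow, mul_one] at h2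
    rw [h, h2]
    push_cast
    ring
  · have h := integral_neg_eq_self (fun x : ℝ => x ^ a * Real.exp (-x ^ 2)) volume
    rw [Nat.not_even_iff_odd] at ha
    simp only [ha.neg_pow, even_two.neg_pow, neg_mul, integral_neg] at h
    linarith

lemma integral_monomial_mul_exp_neg_sq {d : ℕ} (γ : Fin d → ℕ) :
    ∫ x, monomial γ x * Real.exp (-‖x‖ ^ 2) =
      ∏ i, if Even (γ i) then Real.Gamma (((γ i : ℝ) + 1) / 2) else 0 := by
  simp only [← integral_pow_mul_exp_neg_sq]
  rw [← integral_fintype_prod_volume_eq_prod,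
    ← (EuclideanSpace.volume_preserving_symm_measurableEquiv_toLp (Fin d)).integral_comp']
  congr 1 with x
  simp [monomial, Finset.prod_mul_distrib, ← Real.exp_sum, EuclideanSpace.real_norm_sq_eq]

lemma Gamma_even_add_one_half_eq {a : ℕ} (ha : Even a) :
    Real.Gamma (((a : ℝ) + 1) / 2) = doubleFact ((a : ℤ) - 1) * √Real.pi * (2 ^ ((a : ℝ) / 2))⁻¹ := by
  obtain ⟨k, rfl⟩ := ha
  have h := Real.Gamma_nat_add_half k
  have h1 : (((k + k : ℕ) : ℝ) + 1) / 2 = k + 1 / 2 := by push_cast; ring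
  have h2 : ((k + k : ℕ) : ℝ) / 2 = k := by push_cast; ring
  -- At `k = 0` both sides truncate to `0`, in agreement with `(-1)‼ = 0‼ = 1`.
  have h3 : (((k + k : ℕ) : ℤ) - 1).toNat = 2 * k - 1 := by omega
  rw [h1, h2, h, doubleFact, h3, Real.rpow_natCast]
  ring

lemma Gamma_half_eq {n : ℕ} (hn : 1 ≤ n) :
    Real.Gamma ((n : ℝ) / 2) =
      doubleFact ((n : ℤ) - 2) * (if Even n then 2 else √(2 * Real.pi)) *
        (2 ^ ((n : ℝ) / 2))⁻¹ := by
  split_ifs with he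
  · obtain ⟨k, rfl⟩ := he
    obtain ⟨k, rfl⟩ : ∃ l, k = l + 1 := ⟨k - 1, by omega⟩
    have h1 : ((k + 1 + (k + 1) : ℕ) : ℝ) / 2 = ((k + 1 : ℕ) : ℝ) := by push_cast; ring
    have h3 : (((k + 1 + (k + 1) : ℕ) : ℤ) - 2).toNat = 2 * k := by omega
    rw [h1, doubleFact, h3, Real.rpow_natCast, Nat.doubleFactorial_two_mul]
    push_cast
    rw [Real.Gamma_nat_eq_factorial]
    field_simp
    ring
  · obtain ⟨k, rfl⟩ := Nat.not_even_iff_odd.1 he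
    have h1 : ((2 * k + 1 : ℕ) : ℝ) / 2 = k + 1 / 2 := by push_cast; ring
    have h3 : (((2 * k + 1 : ℕ) : ℤ) - 2).toNat = 2 * k - 1 := by omega
    rw [h1, doubleFact, h3, Real.Gamma_nat_add_half, Real.rpow_add two_pos, Real.rpow_natCast,
      ← Real.sqrt_eq_rpow, Real.sqrt_mul two_pos.le]
    field_simp

/-- The integral of `x^γ e^{-‖x‖²}` is computed twice: as a product of one-dimensional integrals,
and in polar coordinates. Dividing by the radial factor `Γ((n + d)/2)/2` leaves the sphere moment.
-/
lemma integral_sphere_monomial {d : ℕ} (hd : 1 ≤ d) (γ : Fin d → ℕ) :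
    ∫ ω : Metric.sphere (0 : EuclideanSpace ℝ (Fin d)) 1, monomial γ ω ∂(volume.toSphere) =
      weight γ := by
  set n := ∑ i, γ i with hn
  have h := integral_homogeneous_mul_radial hd (φ := monomial γ) (monomial_smul γ)
    (fun r => Real.exp (-r ^ 2))
  have h2 := integral_Ioi_pow_mul_exp (n + d - 1) one_le_two one_pos
  simp only [one_mul, Real.one_rpow, mul_one] at h2
  have hnd : ((n + d - 1 : ℕ) : ℝ) + 1 = ((n + d : ℕ) : ℝ) := by
    exact_mod_cast Nat.sub_add_cancel (by omega)
  rw [integral_monomial_mul_exp_neg_sq, h2, hnd] at h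
  have hΓ : 0 < Real.Gamma (((n + d : ℕ) : ℝ) / 2) := Real.Gamma_pos_of_pos (by
    have : (0 : ℝ) < ((n + d : ℕ) : ℝ) := by exact_mod_cast (by omega)
    positivity)
  rw [weight, evenIndicator]
  by_cases he : ∀ i, Even (γ i)
  swap
  · rw [if_neg he, mul_zero]
    push Not at he
    obtain ⟨i, hi⟩ := he
    rw [Finset.prod_eq_zero (Finset.mem_univ i) (if_neg (by simpa using hi))] at h
    -- One odd exponent kills the Gaussian integral; the radial factor is nonzero, so the sphere
    -- moment vanishes.
    have : (1 : ℝ) / (2 : ℕ) * Real.Gamma (((n + d : ℕ) : ℝ) / (2 : ℕ)) ≠ 0 := by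
      rw [Nat.cast_two]; positivity
    exact (mul_eq_zero.1 h.symm).resolve_right this
  have hne : Even n := Finset.even_sum _ fun i _ => he i
  have h4 : (∏ i, if Even (γ i) then Real.Gamma (((γ i : ℝ) + 1) / 2) else 0) =
      (∏ i, doubleFact ((γ i : ℤ) - 1)) * Real.pi ^ ((d : ℝ) / 2) * (2 ^ ((n : ℝ) / 2))⁻¹ := by
    rw [Finset.prod_congr rfl fun i _ => (if_pos (he i)).trans (Gamma_even_add_one_half_eq (he i)),
      Finset.prod_mul_distrib, Finset.prod_mul_distrib, Finset.prod_inv_distrib,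
      ← Real.rpow_sum_of_pos two_pos, ← Finset.sum_div, ← Nat.cast_sum, ← hn, Finset.prod_const,
      Finset.card_univ, Fintype.card_fin, Real.sqrt_eq_rpow, ← Real.rpow_natCast,
      ← Real.rpow_mul Real.pi_pos.le, one_div_mul_eq_div]
  have h5 : (∑ i, (γ i : ℤ)) + (d : ℤ) - 2 = ((n + d : ℕ) : ℤ) - 2 := by
    push_cast [hn]; ring
  have hD : (0 : ℝ) < doubleFact (((n + d : ℕ) : ℤ) - 2) := by
    unfold doubleFact; exact_mod_cast Nat.doubleFactorial_pos _
  rw [h4, Nat.cast_two, Gamma_half_eq (by omega : 1 ≤ n + d)] at h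
  rw [h5, Real.mul_rpow two_pos.le Real.pi_pos.le, if_pos he]
  have h6 : (2 : ℝ) ^ (((n + d : ℕ) : ℝ) / 2) = 2 ^ ((n : ℝ) / 2) * 2 ^ ((d : ℝ) / 2) := by
    rw [← Real.rpow_add two_pos]; push_cast; ring_nf
  rw [h6] at h
  have hp1 : (0 : ℝ) < 2 ^ ((n : ℝ) / 2) := by positivity
  have hp2 : (0 : ℝ) < 2 ^ ((d : ℝ) / 2) := by positivity
  split_ifs with hd2
  · rw [if_pos (hne.add hd2)] at h
    field_simp at h ⊢
    linarith
  · rw [if_neg (by simp [Nat.even_add, hne, hd2])] at h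
    -- As `n` is even, `n + d` is odd here, and `Γ` at a half-integer brings `√(2π)` in place of
    -- `2`; their ratio is the factor `√(2/π)` of `weight`.
    have hs : √(2 / Real.pi) * √(2 * Real.pi) = 2 := by
      rw [← Real.sqrt_mul (by positivity), show 2 / Real.pi * (2 * Real.pi) = 2 ^ 2 by
        field_simp, Real.sqrt_sq two_pos.le]
    have hs2 : 0 < √(2 * Real.pi) := by positivity
    rw [← eq_div_iff hs2.ne'] at hs
    rw [hs]
    field_simp at h ⊢
    linarith

lemma integral_monomial_mul_exp {d : ℕ} (hd : 1 ≤ d) (γ : Fin d → ℕ) {n : ℕ} (hγ : ∑ i, γ i = n)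
    {ν : ℕ} (hν : 1 ≤ ν) {b : ℝ} (hb : 0 < b) :
    ∫ x, monomial γ x * Real.exp (-(b * ‖x‖ ^ ν)) =
      weight γ * (1 / ν * Real.Gamma (((n : ℝ) + d) / ν) * b ^ (-(((n : ℝ) + d) / ν))) := by
  have h := integral_homogeneous_mul_radial hd (φ := monomial γ) (monomial_smul γ)
    (fun r => Real.exp (-(b * r ^ ν)))
  have hnd : ((n + d - 1 : ℕ) : ℝ) + 1 = (n : ℝ) + d := by
    exact_mod_cast Nat.sub_add_cancel (by omega)
  rw [h, integral_sphere_monomial hd, hγ, integral_Ioi_pow_mul_exp _ hν hb, hnd]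

/-- Only the scaling in `b` matters for the error term, so the constant is left unnamed. -/
lemma integral_norm_pow_mul_exp {d : ℕ} (hd : 1 ≤ d) (n : ℕ) {ν : ℕ} (hν : 1 ≤ ν) :
    ∃ I : ℝ, ∀ b : ℝ, 0 < b →
      ∫ x : EuclideanSpace ℝ (Fin d), ‖x‖ ^ n * Real.exp (-(b * ‖x‖ ^ ν)) =
        I * b ^ (-(((n : ℝ) + d) / ν)) := by
  refine ⟨(∫ _ω : Metric.sphere (0 : EuclideanSpace ℝ (Fin d)) 1, (1 : ℝ) ∂(volume.toSphere)) *
    (1 / ν * Real.Gamma (((n : ℝ) + d) / ν)), fun b hb => ?_⟩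
  have h := integral_homogeneous_mul_radial hd (φ := fun _ => 1) (n := 0) (by simp)
    (fun r => r ^ n * Real.exp (-(b * r ^ ν)))
  have hnd : ((0 + d - 1 + n : ℕ) : ℝ) + 1 = (n : ℝ) + d := by
    rw [add_comm (n : ℝ)]
    exact_mod_cast (by omega)
  simp only [one_mul, ← mul_assoc, ← pow_add] at h
  rw [h, integral_Ioi_pow_mul_exp _ hν hb, hnd]
  ring

lemma integrable_norm_pow_mul_exp {d : ℕ} (hd : 1 ≤ d) (n : ℕ) {ν : ℕ} (hν : 1 ≤ ν) {b : ℝ}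
    (hb : 0 < b) :
    Integrable fun x : EuclideanSpace ℝ (Fin d) => ‖x‖ ^ n * Real.exp (-(b * ‖x‖ ^ ν)) := by
  have : NeZero d := ⟨by omega⟩
  refine (integrable_fun_norm_addHaar volume
    (f := fun r : ℝ => r ^ n * Real.exp (-(b * r ^ ν)))).2 ?_
  simp only [smul_eq_mul, ← mul_assoc, ← pow_add]
  exact integrableOn_Ioi_pow_mul_exp _ hν hb

lemma integrable_monomial_mul_exp {d : ℕ} (hd : 1 ≤ d) (γ : Fin d → ℕ) {ν : ℕ} (hν : 1 ≤ ν)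
    {b : ℝ} (hb : 0 < b) :
    Integrable fun x : EuclideanSpace ℝ (Fin d) =>
      monomial γ x * Real.exp (-(b * ‖x‖ ^ ν)) := by
  refine (integrable_norm_pow_mul_exp hd (∑ i, γ i) hν hb).mono' ?_ (.of_forall fun x => ?_)
  · exact ((continuous_monomial γ).mul (by fun_prop)).aestronglyMeasurable
  · rw [norm_mul, Real.norm_of_nonneg (Real.exp_pos _).le, Real.norm_eq_abs]
    exact mul_le_mul_of_nonneg_right (abs_monomial_le γ x) (Real.exp_pos _).le

/-! ### Products of expansions with remainder. -/

lemma isBigO_norm_pow_of_le {E : Type*} [NormedAddCommGroup E] {a b : ℕ} (h : b ≤ a) :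
    (fun x : E => ‖x‖ ^ a) =O[𝓝 0] fun x => ‖x‖ ^ b := by
  refine IsBigO.of_bound 1 ?_
  filter_upwards [Metric.closedBall_mem_nhds (0 : E) one_pos] with x hx
  rw [mem_closedBall_zero_iff] at hx
  simpa using pow_le_pow_of_le_one (norm_nonneg x) hx h

/-- Matches the grading by total degree with the tuples that arise when the `r`-th power of a sum
over `1, …, N` is multiplied out. Positive parts with sum at most `N` are themselves at most `N`. -/
lemma sum_sum_orderedPartitions (N r : ℕ) (φ : (Fin r → ℕ) → ℝ) :
    ∑ m ∈ Finset.range (N + 1), ∑ n ∈ orderedPartitions r m, φ n =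
      ∑ n ∈ Fintype.piFinset (fun _ : Fin r => Finset.Icc 1 N) with ∑ i, n i ≤ N, φ n := by
  rw [← Finset.sum_fiberwise_of_maps_to (t := Finset.range (N + 1)) (g := fun n : Fin r → ℕ => ∑ i, n i)
    fun n hn => by simpa [Nat.lt_succ_iff] using (Finset.mem_filter.1 hn).2]
  refine Finset.sum_congr rfl fun m hm => Finset.sum_congr ?_ fun _ _ => rfl
  ext n
  simp only [orderedPartitions, Finset.mem_filter, Finset.mem_piAntidiag, Fintype.mem_piFinset,
    Finset.mem_Icc, Finset.mem_range] at hm ⊢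
  constructor
  · rintro ⟨⟨h0, -⟩, h1⟩
    replace h0 : ∑ i, n i = m := h0
    refine ⟨⟨fun i => ⟨h1 i, ?_⟩, by omega⟩, h0⟩
    have : n i ≤ ∑ i, n i := Finset.single_le_sum (f := n) (fun _ _ => Nat.zero_le _) (Finset.mem_univ i)
    omega
  · rintro ⟨⟨h1, -⟩, rfl⟩
    exact ⟨⟨rfl, by simp⟩, fun i => (h1 i).1⟩

section Expansion

variable {E : Type*} [NormedAddCommGroup E] {N ν : ℕ} {F g : E → ℝ} {P G : ℕ → E → ℝ}

lemma isBigO_prod (hP : ∀ n, P n =O[𝓝 0] fun x => ‖x‖ ^ (n + ν)) {r : ℕ} (n : Fin r → ℕ) :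
    (fun x => ∏ i, P (n i) x) =O[𝓝 0] fun x => ‖x‖ ^ (r * ν + ∑ i, n i) := by
  have h := IsBigO.finsetProd (s := Finset.univ) fun (i : Fin r) _ => hP (n i)
  refine h.congr_right fun x => ?_
  rw [Finset.prod_pow_eq_pow_sum]
  simp [Finset.sum_add_distrib, add_comm]

/-- With `H` the truncated sum, `F ^ r` is first replaced by `H ^ r`, then `H ^ r` is multiplied
out, where tuples of total above `N` are negligible. Each factor other than the error contributes
`‖x‖ ^ ν`, whence the exponent `rν + N + 1`. -/
lemma pow_isBigO_expansion (hP : ∀ n, P n =O[𝓝 0] fun x => ‖x‖ ^ (n + ν))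
    (hF : (fun x => F x - ∑ n ∈ Finset.Icc 1 N, P n x) =O[𝓝 0] fun x => ‖x‖ ^ (N + ν + 1))
    (r : ℕ) :
    (fun x => F x ^ r - ∑ m ∈ Finset.range (N + 1), ∑ n ∈ orderedPartitions r m,
      ∏ i, P (n i) x) =O[𝓝 0] fun x => ‖x‖ ^ (r * ν + N + 1) := by
  have hH : (fun x => ∑ n ∈ Finset.Icc 1 N, P n x) =O[𝓝 0] fun x => ‖x‖ ^ ν :=
    IsBigO.fun_sum fun n _ => (hP n).trans (isBigO_norm_pow_of_le (by omega))
  have hF' : F =O[𝓝 0] fun x => ‖x‖ ^ ν := by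
    simpa using (hF.trans (isBigO_norm_pow_of_le (by omega))).add hH
  have h1 : ∀ r : ℕ, (fun x => F x ^ r - (∑ n ∈ Finset.Icc 1 N, P n x) ^ r) =O[𝓝 0]
      fun x => ‖x‖ ^ (r * ν + N + 1) := by
    intro r
    induction r with
    | zero => simpa using isBigO_zero _ _
    | succ r ih =>
      -- `F ^ (r+1) - H ^ (r+1) = F ^ r (F - H) + (F ^ r - H ^ r) H`.
      have ha := ((hF'.pow r).mul hF).add ((ih.mul hH).congr_right
        (g₂ := fun x => (‖x‖ ^ ν) ^ r * ‖x‖ ^ (N + ν + 1)) fun x => by ring)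
      exact ha.congr (fun x => by ring) fun x => by ring
  have h2 : (fun x => (∑ n ∈ Finset.Icc 1 N, P n x) ^ r -
      ∑ m ∈ Finset.range (N + 1), ∑ n ∈ orderedPartitions r m, ∏ i, P (n i) x) =O[𝓝 0]
      fun x => ‖x‖ ^ (r * ν + N + 1) := by
    have h3 : (fun x => ∑ n ∈ Fintype.piFinset (fun _ : Fin r => Finset.Icc 1 N) with
        ¬ ∑ i, n i ≤ N, ∏ i, P (n i) x) =O[𝓝 0] fun x => ‖x‖ ^ (r * ν + N + 1) := by
      refine IsBigO.fun_sum fun n hn => (isBigO_prod hP n).trans (isBigO_norm_pow_of_le ?_)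
      have := (Finset.mem_filter.1 hn).2
      omega
    refine h3.congr_left fun x => ?_
    have h4 := Finset.prod_univ_sum (fun _ : Fin r => Finset.Icc 1 N) (fun _ n => P n x)
    rw [Finset.prod_const, Finset.card_univ, Fintype.card_fin] at h4
    rw [sum_sum_orderedPartitions N r (fun n => ∏ i, P (n i) x), h4,
      ← Finset.sum_filter_add_sum_filter_not (Fintype.piFinset fun _ : Fin r => Finset.Icc 1 N)
        (fun n : Fin r → ℕ => ∑ i, n i ≤ N)]
    ring
  simpa using (h1 r).add h2

lemma pow_mul_isBigO_expansion (hP : ∀ n, P n =O[𝓝 0] fun x => ‖x‖ ^ (n + ν))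
    (hG : ∀ l, G l =O[𝓝 0] fun x => ‖x‖ ^ l)
    (hF : (fun x => F x - ∑ n ∈ Finset.Icc 1 N, P n x) =O[𝓝 0] fun x => ‖x‖ ^ (N + ν + 1))
    (hg : (fun x => g x - ∑ l ∈ Finset.range (N + 1), G l x) =O[𝓝 0] fun x => ‖x‖ ^ (N + 1))
    (r : ℕ) :
    (fun x => F x ^ r * g x - ∑ j ∈ Finset.range (N + 1), ∑ m ∈ Finset.range (j + 1),
      G (j - m) x * ∑ n ∈ orderedPartitions r m, ∏ i, P (n i) x) =O[𝓝 0]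
      fun x => ‖x‖ ^ (r * ν + N + 1) := by
  have hQ : ∀ m, (fun x => ∑ n ∈ orderedPartitions r m, ∏ i, P (n i) x) =O[𝓝 0]
      fun x => ‖x‖ ^ (r * ν + m) := fun m => IsBigO.fun_sum fun n hn => by
    have h : ∑ i, n i = m := by simpa using (Finset.mem_filter.1 hn).1
    simpa [h] using isBigO_prod hP n
  set Q : ℕ → E → ℝ := fun m x => ∑ n ∈ orderedPartitions r m, ∏ i, P (n i) x with hQdef
  have hGs : (fun x => ∑ l ∈ Finset.range (N + 1), G l x) =O[𝓝 0] fun x => ‖x‖ ^ 0 :=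
    IsBigO.fun_sum fun l _ => (hG l).trans (isBigO_norm_pow_of_le (by omega))
  have hg' : g =O[𝓝 0] fun x => ‖x‖ ^ 0 := by
    simpa using (hg.trans (isBigO_norm_pow_of_le (Nat.zero_le _))).add hGs
  have hQs : (fun x => ∑ m ∈ Finset.range (N + 1), Q m x) =O[𝓝 0] fun x => ‖x‖ ^ (r * ν) :=
    IsBigO.fun_sum fun m _ => (hQ m).trans (isBigO_norm_pow_of_le (by omega))
  have h1 := ((pow_isBigO_expansion hP hF r).mul hg').add ((hQs.mul hg).congr_right
    (g₂ := fun x => ‖x‖ ^ (r * ν + N + 1) * ‖x‖ ^ 0) fun x => by ring)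
  -- These are the pairs with `m + l ≥ N + 1`: the full product of the two truncated sums minus the
  -- triangle `m + l ≤ N`.
  have h2 : (fun x => ∑ m ∈ Finset.range (N + 1), ∑ l ∈ Finset.Ico (N + 1 - m) (N + 1),
      Q m x * G l x) =O[𝓝 0] fun x => ‖x‖ ^ (r * ν + N + 1) := by
    refine IsBigO.fun_sum fun m _ => IsBigO.fun_sum fun l hl => ?_
    refine ((hQ m).mul (hG l)).trans ?_
    simp only [← pow_add]
    rw [Finset.mem_Ico] at hl
    exact isBigO_norm_pow_of_le (by omega)
  refine ((h1.congr_right (g₂ := fun x => ‖x‖ ^ (r * ν + N + 1)) fun x => by ring).add h2).congr_left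
    fun x => ?_
  have h3 := Finset.sum_range_diag_flip (N + 1) fun m l => Q m x * G l x
  have h4 : ∑ m ∈ Finset.range (N + 1), ∑ l ∈ Finset.Ico (N + 1 - m) (N + 1), Q m x * G l x =
      (∑ m ∈ Finset.range (N + 1), Q m x) * (∑ l ∈ Finset.range (N + 1), G l x) -
        ∑ m ∈ Finset.range (N + 1), ∑ l ∈ Finset.range (N + 1 - m), Q m x * G l x := by
    rw [Finset.sum_mul_sum, ← Finset.sum_sub_distrib]
    refine Finset.sum_congr rfl fun m _ => ?_
    rw [Finset.sum_Ico_eq_sub _ (Nat.sub_le _ _)]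
  have h5 : ∑ j ∈ Finset.range (N + 1), ∑ m ∈ Finset.range (j + 1), G (j - m) x * Q m x =
      ∑ m ∈ Finset.range (N + 1), ∑ l ∈ Finset.range (N + 1 - m), Q m x * G l x := by
    rw [← h3]
    exact Finset.sum_congr rfl fun j _ => Finset.sum_congr rfl fun m _ => mul_comm _ _
  change _ = F x ^ r * g x - ∑ j ∈ Finset.range (N + 1), ∑ m ∈ Finset.range (j + 1),
    G (j - m) x * Q m x
  rw [h4, h5]
  ring

end Expansion

/-! ### Homogeneous Taylor parts and the integrals of their products. -/

lemma taylorPart_smul {d : ℕ} (u : EuclideanSpace ℝ (Fin d) → ℝ) (n : ℕ) (t : ℝ)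
    (x : EuclideanSpace ℝ (Fin d)) : taylorPart u n (t • x) = t ^ n * taylorPart u n x := by
  rw [taylorPart, taylorPart, Finset.mul_sum]
  refine Finset.sum_congr rfl fun α hα => ?_
  rw [monomial_smul, mem_multiIndices.1 hα]
  ring

lemma exists_abs_taylorPart_le {d : ℕ} (u : EuclideanSpace ℝ (Fin d) → ℝ) (n : ℕ) :
    ∃ C, 0 ≤ C ∧ ∀ x, |taylorPart u n x| ≤ C * ‖x‖ ^ n := by
  refine ⟨∑ α ∈ multiIndices d n, |mixedDeriv α u 0 / (multiFactorial α : ℝ)|,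
    Finset.sum_nonneg fun _ _ => abs_nonneg _, fun x => ?_⟩
  rw [taylorPart, Finset.sum_mul]
  refine (Finset.abs_sum_le_sum_abs _ _).trans (Finset.sum_le_sum fun α hα => ?_)
  rw [abs_mul, ← mem_multiIndices.1 hα]
  exact mul_le_mul_of_nonneg_left (abs_monomial_le α x) (abs_nonneg _)

lemma taylorPart_isBigO {d : ℕ} (u : EuclideanSpace ℝ (Fin d) → ℝ) (n : ℕ) :
    taylorPart u n =O[𝓝 0] fun x => ‖x‖ ^ n := by
  obtain ⟨C, -, hC⟩ := exists_abs_taylorPart_le u n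
  exact IsBigO.of_bound C (.of_forall fun x => by simpa using hC x)

lemma taylorPart_eq_mul_norm_pow {d : ℕ} {u : EuclideanSpace ℝ (Fin d) → ℝ} {ν : ℕ} (hν : 1 ≤ ν)
    {c : ℝ} (hc : ∀ Ω ∈ Metric.sphere (0 : EuclideanSpace ℝ (Fin d)) 1, taylorPart u ν Ω = c)
    (x : EuclideanSpace ℝ (Fin d)) : taylorPart u ν x = c * ‖x‖ ^ ν := by
  rcases eq_or_ne x 0 with rfl | hx
  · have h := taylorPart_smul u ν 0 (0 : EuclideanSpace ℝ (Fin d))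
    rw [zero_pow (by omega), zero_smul, zero_mul] at h
    rw [h, norm_zero, zero_pow (by omega), mul_zero]
  · have h := taylorPart_smul u ν ‖x‖ (‖x‖⁻¹ • x)
    rw [smul_inv_smul₀ (norm_ne_zero_iff.2 hx), hc (‖x‖⁻¹ • x) (by simp [norm_smul, hx])] at h
    rw [h, mul_comm]

/-- The terms of degree `l` in `g`, of degree `r` in `f`, and of order `l + m + r ν` in `x`, of
the product of the Taylor expansions of `g` and of `(f - f₀ ‖x‖ ^ ν) ^ r`. -/
noncomputable def expansionTerm {d : ℕ} (f g : EuclideanSpace ℝ (Fin d) → ℝ) (ν l m r : ℕ)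
    (x : EuclideanSpace ℝ (Fin d)) : ℝ :=
  taylorPart g l x * ∑ n ∈ orderedPartitions r m, ∏ i, taylorPart f (n i + ν) x

lemma sum_orderedPartition {r m : ℕ} {n : Fin r → ℕ} (hn : n ∈ orderedPartitions r m) :
    ∑ i, n i = m := by
  simpa using (Finset.mem_filter.1 hn).1

lemma expansionTerm_eq {d : ℕ} (f g : EuclideanSpace ℝ (Fin d) → ℝ) (ν l m r : ℕ)
    (x : EuclideanSpace ℝ (Fin d)) :
    expansionTerm f g ν l m r x =
      ∑ β ∈ multiIndices d l, ∑ n ∈ orderedPartitions r m,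
        ∑ α ∈ Fintype.piFinset fun i : Fin r => multiIndices d (n i + ν),
          ((mixedDeriv β g 0 * ∏ i, mixedDeriv (α i) f 0) /
            ((multiFactorial β : ℝ) * ∏ i, (multiFactorial (α i) : ℝ))) *
          monomial (β + ∑ i, α i) x := by
  rw [expansionTerm, taylorPart, Finset.sum_mul_sum]
  refine Finset.sum_congr rfl fun β _ => Finset.sum_congr rfl fun n _ => ?_
  simp only [taylorPart]
  rw [Finset.prod_univ_sum, Finset.mul_sum]
  refine Finset.sum_congr rfl fun α _ => ?_
  rw [monomial_add_sum, Finset.prod_mul_distrib, Finset.prod_div_distrib]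
  ring

lemma sum_add_sum_multiIndices {d ν l m r : ℕ} {β : Fin d → ℕ} (hβ : β ∈ multiIndices d l)
    {n : Fin r → ℕ} (hn : n ∈ orderedPartitions r m) {α : Fin r → Fin d → ℕ}
    (hα : α ∈ Fintype.piFinset fun i : Fin r => multiIndices d (n i + ν)) :
    ∑ i, (β + ∑ k, α k) i = l + m + r * ν := by
  have h : ∀ k, ∑ i, α k i = n k + ν := fun k =>
    mem_multiIndices.1 (Fintype.mem_piFinset.1 hα k)
  simp only [Pi.add_apply, Finset.sum_apply, Finset.sum_add_distrib]
  rw [Finset.sum_comm, mem_multiIndices.1 hβ]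
  simp [h, Finset.sum_add_distrib, sum_orderedPartition hn, add_assoc]

lemma exists_abs_expansionTerm_le {d : ℕ} (f g : EuclideanSpace ℝ (Fin d) → ℝ) (ν l m r : ℕ) :
    ∃ C, 0 ≤ C ∧ ∀ x, |expansionTerm f g ν l m r x| ≤ C * ‖x‖ ^ (l + m + r * ν) := by
  refine ⟨∑ β ∈ multiIndices d l, ∑ n ∈ orderedPartitions r m,
        ∑ α ∈ Fintype.piFinset fun i : Fin r => multiIndices d (n i + ν),
          |(mixedDeriv β g 0 * ∏ i, mixedDeriv (α i) f 0) /
            ((multiFactorial β : ℝ) * ∏ i, (multiFactorial (α i) : ℝ))|,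
    Finset.sum_nonneg fun _ _ => Finset.sum_nonneg fun _ _ => Finset.sum_nonneg fun _ _ =>
      abs_nonneg _, fun x => ?_⟩
  rw [expansionTerm_eq]
  simp only [Finset.sum_mul]
  refine (Finset.abs_sum_le_sum_abs _ _).trans (Finset.sum_le_sum fun β hβ => ?_)
  refine (Finset.abs_sum_le_sum_abs _ _).trans (Finset.sum_le_sum fun n hn => ?_)
  refine (Finset.abs_sum_le_sum_abs _ _).trans (Finset.sum_le_sum fun α hα => ?_)
  rw [abs_mul, ← sum_add_sum_multiIndices hβ hn hα]
  exact mul_le_mul_of_nonneg_left (abs_monomial_le _ x) (abs_nonneg _)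

lemma integrable_expansionTerm_mul_exp {d : ℕ} (hd : 1 ≤ d) (f g : EuclideanSpace ℝ (Fin d) → ℝ)
    {ν : ℕ} (hν : 1 ≤ ν) (l m r : ℕ) {b : ℝ} (hb : 0 < b) :
    Integrable fun x => expansionTerm f g ν l m r x * Real.exp (-(b * ‖x‖ ^ ν)) := by
  simp only [expansionTerm_eq, Finset.sum_mul, mul_assoc]
  exact integrable_finsetSum _ fun β _ => integrable_finsetSum _ fun n _ =>
    integrable_finsetSum _ fun α _ => (integrable_monomial_mul_exp hd _ hν hb).const_mul _

lemma integral_expansionTerm_mul_exp {d : ℕ} (hd : 1 ≤ d) (f g : EuclideanSpace ℝ (Fin d) → ℝ)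
    {ν : ℕ} (hν : 1 ≤ ν) (l m r : ℕ) {b : ℝ} (hb : 0 < b) :
    ∫ x, expansionTerm f g ν l m r x * Real.exp (-(b * ‖x‖ ^ ν)) =
      innerSum f g ν l m r * (1 / ν * Real.Gamma (((l + m + r * ν : ℕ) + d : ℝ) / ν) *
        b ^ (-(((l + m + r * ν : ℕ) + d : ℝ) / ν))) := by
  have hi : ∀ γ : Fin d → ℕ, ∀ c : ℝ, Integrable fun x : EuclideanSpace ℝ (Fin d) =>
      c * (monomial γ x * Real.exp (-(b * ‖x‖ ^ ν))) := fun γ c =>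
    (integrable_monomial_mul_exp hd γ hν hb).const_mul c
  simp only [expansionTerm_eq, Finset.sum_mul, mul_assoc, innerSum]
  rw [integral_finsetSum _ fun β _ => integrable_finsetSum _ fun n _ =>
    integrable_finsetSum _ fun α _ => hi _ _]
  refine Finset.sum_congr rfl fun β hβ => ?_
  rw [integral_finsetSum _ fun n _ => integrable_finsetSum _ fun α _ => hi _ _]
  refine Finset.sum_congr rfl fun n hn => ?_
  rw [integral_finsetSum _ fun α _ => hi _ _]
  refine Finset.sum_congr rfl fun α hα => ?_
  rw [integral_const_mul,
    integral_monomial_mul_exp hd _ (sum_add_sum_multiIndices hβ hn hα) hν hb]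
  ring

/-! ### Identification of the coefficients. -/

/-- `(-s)(-s-1)⋯(-s-r+1) = (-1) ^ r s(s+1)⋯(s+r-1)`, and the rising product is `Γ(s + r)/Γ(s)`. -/
lemma choose_neg_mul_Gamma {s : ℝ} (hs : 0 < s) (r : ℕ) :
    Ring.choose (-s) r * Real.Gamma s = (-1) ^ r / (r.factorial : ℝ) * Real.Gamma (s + r) := by
  have h : (r.factorial : ℝ) * Ring.choose (-s) r * Real.Gamma s =
      (-1) ^ r * Real.Gamma (s + r) := by
    rw [← nsmul_eq_mul, ← Ring.descPochhammer_eq_factorial_smul_choose]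
    induction r with
    | zero => simp
    | succ r ih =>
      have h1 : Real.Gamma (s + (r + 1 : ℕ)) = (s + r) * Real.Gamma (s + r) := by
        rw [Nat.cast_succ, ← add_assoc, Real.Gamma_add_one (by positivity)]
      rw [h1, descPochhammer_succ_right, Polynomial.smeval_mul, Polynomial.smeval_sub,
        Polynomial.smeval_X, Polynomial.smeval_natCast, pow_succ]
      simp only [pow_zero, nsmul_eq_mul, mul_one]
      linear_combination (-s - r) * ih
  have hr : (r.factorial : ℝ) ≠ 0 := by positivity
  field_simp
  linarith

lemma orderedPartitions_eq_empty {r m : ℕ} (h : m < r) : orderedPartitions r m = ∅ := by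
  refine Finset.eq_empty_of_forall_notMem fun n hn => ?_
  have h1 := sum_orderedPartition hn
  have h2 : ∑ _i : Fin r, 1 ≤ ∑ i, n i :=
    Finset.sum_le_sum fun i _ => (Finset.mem_filter.1 hn).2 i
  simp at h2
  omega

lemma orderedPartitions_zero_left {m : ℕ} (h : m ≠ 0) : orderedPartitions 0 m = ∅ :=
  Finset.eq_empty_of_forall_notMem fun n hn => h (by simpa using (sum_orderedPartition hn).symm)

lemma innerSum_zero_zero {d : ℕ} (f g : EuclideanSpace ℝ (Fin d) → ℝ) (ν l : ℕ) :
    innerSum f g ν l 0 0 =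
      ∑ β ∈ multiIndices d l, weight β * (mixedDeriv β g 0 / (multiFactorial β : ℝ)) := by
  have h : orderedPartitions 0 0 = {![]} :=
    Finset.eq_singleton_iff_unique_mem.2
      ⟨by simp [orderedPartitions], fun n _ => Subsingleton.elim n _⟩
  simp [innerSum, h]

lemma sum_innerSum_eq_zeta {d : ℕ} (hd : 1 ≤ d) (f g : EuclideanSpace ℝ (Fin d) → ℝ) {ν : ℕ}
    (hν : 1 ≤ ν) {N j : ℕ} (hj : j ≤ N) {f₀ k : ℝ} (hf₀ : 0 < f₀) (hk : 0 < k) :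
    ∑ m ∈ Finset.range (j + 1), ∑ r ∈ Finset.range (N + 1), (-k) ^ r / (r.factorial : ℝ) *
      (innerSum f g ν (j - m) m r *
        (1 / ν * Real.Gamma (((j - m + m + r * ν : ℕ) + d : ℝ) / ν) *
          (k * f₀) ^ (-(((j - m + m + r * ν : ℕ) + d : ℝ) / ν)))) =
      k ^ (-((d : ℝ) / ν)) * (zeta f g ν f₀ j * k ^ (-((j : ℝ) / ν))) := by
  have hν' : (0 : ℝ) < ν := by exact_mod_cast hν
  have hd' : (0 : ℝ) < d := by exact_mod_cast hd
  set s : ℝ := ((d : ℝ) + j) / ν with hs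
  have hs0 : 0 < s := by positivity
  have hterm : ∀ m ∈ Finset.range (j + 1), ∀ r : ℕ, (-k) ^ r / (r.factorial : ℝ) *
      (innerSum f g ν (j - m) m r *
        (1 / ν * Real.Gamma (((j - m + m + r * ν : ℕ) + d : ℝ) / ν) *
          (k * f₀) ^ (-(((j - m + m + r * ν : ℕ) + d : ℝ) / ν)))) =
      (k ^ (-s) * (1 / ν * Real.Gamma s * f₀ ^ (-s))) *
        (Ring.choose (-s) r * (f₀ ^ r)⁻¹ * innerSum f g ν (j - m) m r) := by
    intro m hm r
    have hjm : j - m + m = j := Nat.sub_add_cancel (by simpa [Nat.lt_succ_iff] using hm)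
    have h1 : ((j - m + m + r * ν : ℕ) + d : ℝ) / ν = s + r := by
      rw [hjm, hs]; push_cast; field_simp; ring
    -- The factor `(k ^ r)⁻¹` cancels the `k ^ r` of the exponential series, so all `r` contribute
    -- at the same order `k ^ (-s)`.
    have h2 : (k * f₀) ^ (-(s + r)) = k ^ (-s) * (k ^ r)⁻¹ * (f₀ ^ (-s) * (f₀ ^ r)⁻¹) := by
      rw [Real.mul_rpow hk.le hf₀.le, neg_add, Real.rpow_add hk, Real.rpow_add hf₀,
        Real.rpow_neg hk.le r, Real.rpow_neg hf₀.le r, Real.rpow_natCast, Real.rpow_natCast]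
    have h3 := choose_neg_mul_Gamma hs0 r
    have hkr : (k ^ r) ≠ 0 := by positivity
    rw [h1, h2, neg_pow k]
    calc _ = k ^ r * (k ^ r)⁻¹ * (innerSum f g ν (j - m) m r * (1 / ν) * k ^ (-s) * f₀ ^ (-s) *
          (f₀ ^ r)⁻¹ * ((-1) ^ r / (r.factorial : ℝ) * Real.Gamma (s + r))) := by ring
      _ = _ := by rw [← h3, mul_inv_cancel₀ hkr]; ring
  -- Parts `nᵢ ≥ 1` force `r ≤ m`, and `r = 0` is possible only for `m = 0`; since `m ≤ j ≤ N`, no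
  -- nonzero term is lost in truncating at `r ≤ N`.
  have hsum : ∀ m ∈ Finset.range (j + 1), ∑ r ∈ Finset.range (N + 1),
      Ring.choose (-s) r * (f₀ ^ r)⁻¹ * innerSum f g ν (j - m) m r =
      if m = 0 then ∑ β ∈ multiIndices d j, weight β * (mixedDeriv β g 0 / (multiFactorial β : ℝ))
      else ∑ r ∈ Finset.Icc 1 m, Ring.choose (-s) r * (f₀ ^ r)⁻¹ *
        innerSum f g ν (j - m) m r := by
    intro m hm
    rw [Finset.mem_range] at hm
    have hz : ∀ r, m < r → innerSum f g ν (j - m) m r = 0 := fun r hr => by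
      simp [innerSum, orderedPartitions_eq_empty hr]
    split_ifs with h0
    · subst h0
      rw [Finset.sum_eq_single 0, Nat.sub_zero, innerSum_zero_zero]
      · simp
      · intro r _ hr
        rw [hz r (by omega), mul_zero]
      · simp
    · symm
      refine Finset.sum_subset (fun r hr => ?_) fun r _ hr => ?_
      · simp at hr ⊢; omega
      · rcases Nat.eq_zero_or_pos r with rfl | hr0
        · simp [innerSum, orderedPartitions_zero_left h0]
        · rw [hz r (by simp at hr; omega), mul_zero]
  have hks : k ^ (-s) = k ^ (-((d : ℝ) / ν)) * k ^ (-((j : ℝ) / ν)) := by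
    rw [← Real.rpow_add hk, hs]; congr 1; ring
  rw [zeta, ← Finset.sum_congr rfl hsum, add_comm (j : ℝ) d, ← hs,
    Finset.sum_congr rfl fun m hm => Finset.sum_congr rfl fun r _ => hterm m hm r]
  simp only [← Finset.mul_sum]
  rw [hks]
  ring

/-! ### Pointwise error of the expanded exponential. -/

lemma abs_exp_sub_sum_le (y : ℝ) (n : ℕ) :
    |Real.exp y - ∑ r ∈ Finset.range n, y ^ r / (r.factorial : ℝ)| ≤ |y| ^ n * Real.exp |y| := by
  have h := Complex.norm_exp_sub_sum_le_norm_mul_exp (y : ℂ) n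
  rw [Complex.norm_real, Real.norm_eq_abs] at h
  refine le_trans (le_of_eq ?_) h
  rw [← Real.norm_eq_abs, ← Complex.norm_real]
  push_cast
  rfl

lemma abs_neg_pow_div_factorial_le {k : ℝ} (hk : 0 ≤ k) (r : ℕ) :
    |(-k) ^ r / (r.factorial : ℝ)| ≤ k ^ r := by
  rw [abs_div, abs_pow, abs_neg, abs_of_nonneg hk, Nat.abs_cast]
  have h : (1 : ℝ) ≤ r.factorial := by exact_mod_cast r.factorial_pos
  exact div_le_self (pow_nonneg hk r) h

/-- The condition `M ρ ≤ f₀ / 2` gives `|kΦ| ≤ k (f₀/2) ρ ^ ν`, so half of the decay absorbs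
`e^{|kΦ|}` and the other half remains. In the constant, `M ^ (N + 2)` comes from `Φ ^ (N + 1) γ` in
the exponential remainder and `M` from the errors of the `K r`. -/
lemma abs_exp_mul_sub_sum_le {N ν : ℕ} {ρ Φ γ M k f₀ : ℝ} {K : ℕ → ℝ} (hk : 0 ≤ k) (hρ : 0 ≤ ρ)
    (hM : 0 ≤ M) (hΦ : |Φ| ≤ M * ρ ^ (ν + 1)) (hMρ : M * ρ ≤ f₀ / 2) (hγ : |γ| ≤ M)
    (hK : ∀ r ∈ Finset.range (N + 1), |Φ ^ r * γ - K r| ≤ M * ρ ^ (r * ν + N + 1)) :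
    |Real.exp (-(k * (f₀ * ρ ^ ν + Φ))) * γ - ∑ r ∈ Finset.range (N + 1),
        (-k) ^ r / (r.factorial : ℝ) * (K r * Real.exp (-(k * f₀ * ρ ^ ν)))| ≤
      (M ^ (N + 2) + M) * ∑ r ∈ Finset.range (N + 2),
        k ^ r * (ρ ^ (r * ν + N + 1) * Real.exp (-(k * (f₀ / 2) * ρ ^ ν))) := by
  set e₀ := Real.exp (-(k * f₀ * ρ ^ ν)) with he₀
  set e₁ := Real.exp (-(k * (f₀ / 2) * ρ ^ ν)) with he₁
  have hf₀ : 0 ≤ f₀ := by linarith [mul_nonneg hM hρ]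
  have hy : |-(k * Φ)| ≤ k * M * ρ ^ (ν + 1) := by
    rw [abs_neg, abs_mul, abs_of_nonneg hk, mul_assoc]
    exact mul_le_mul_of_nonneg_left hΦ hk
  have hy' : |-(k * Φ)| ≤ k * (f₀ / 2) * ρ ^ ν := hy.trans (by
    have := mul_le_mul_of_nonneg_left hMρ (mul_nonneg hk (pow_nonneg hρ ν))
    calc _ = k * ρ ^ ν * (M * ρ) := by ring
      _ ≤ _ := this
      _ = _ := by ring)
  have hee : e₀ * Real.exp |-(k * Φ)| ≤ e₁ := by
    rw [he₀, he₁, ← Real.exp_add]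
    refine Real.exp_le_exp.2 ?_
    linarith
  have he : e₀ ≤ e₁ := by
    refine le_trans ?_ hee
    exact le_mul_of_one_le_right (Real.exp_pos _).le (Real.one_le_exp (abs_nonneg _))
  set S := ∑ r ∈ Finset.range (N + 1), (-(k * Φ)) ^ r / (r.factorial : ℝ) with hS
  have h1 : e₀ * (|Real.exp (-(k * Φ)) - S| * |γ|) ≤
      M ^ (N + 2) * (k ^ (N + 1) * (ρ ^ ((N + 1) * ν + N + 1) * e₁)) := by
    have ha : |-(k * Φ)| ^ (N + 1) ≤ (k * M * ρ ^ (ν + 1)) ^ (N + 1) :=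
      pow_le_pow_left₀ (abs_nonneg _) hy _
    calc e₀ * (|Real.exp (-(k * Φ)) - S| * |γ|)
        ≤ e₀ * ((|-(k * Φ)| ^ (N + 1) * Real.exp |-(k * Φ)|) * M) := by
          gcongr
          exact abs_exp_sub_sum_le _ _
      _ = |-(k * Φ)| ^ (N + 1) * (e₀ * Real.exp |-(k * Φ)|) * M := by ring
      _ ≤ (k * M * ρ ^ (ν + 1)) ^ (N + 1) * e₁ * M := by gcongr
      _ = _ := by ring
  have h2 : e₀ * |∑ r ∈ Finset.range (N + 1), (-k) ^ r / (r.factorial : ℝ) * (Φ ^ r * γ - K r)| ≤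
      M * ∑ r ∈ Finset.range (N + 1), k ^ r * (ρ ^ (r * ν + N + 1) * e₁) := by
    rw [Finset.mul_sum]
    refine (mul_le_mul_of_nonneg_left (Finset.abs_sum_le_sum_abs _ _) (Real.exp_pos _).le).trans ?_
    rw [Finset.mul_sum]
    refine Finset.sum_le_sum fun r hr => ?_
    have hfac : |(-k) ^ r / (r.factorial : ℝ)| ≤ k ^ r := abs_neg_pow_div_factorial_le hk r
    rw [abs_mul]
    calc _ ≤ e₁ * (k ^ r * (M * ρ ^ (r * ν + N + 1))) := by
          gcongr
          exact hK r hr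
      _ = _ := by ring
  have heq : Real.exp (-(k * (f₀ * ρ ^ ν + Φ))) * γ - ∑ r ∈ Finset.range (N + 1),
        (-k) ^ r / (r.factorial : ℝ) * (K r * e₀) =
      e₀ * ((Real.exp (-(k * Φ)) - S) * γ) +
        e₀ * ∑ r ∈ Finset.range (N + 1), (-k) ^ r / (r.factorial : ℝ) * (Φ ^ r * γ - K r) := by
    have h3 : Real.exp (-(k * (f₀ * ρ ^ ν + Φ))) = e₀ * Real.exp (-(k * Φ)) := by
      rw [he₀, ← Real.exp_add]; ring_nf
    have h4 : ∑ r ∈ Finset.range (N + 1), (-k) ^ r / (r.factorial : ℝ) * (Φ ^ r * γ - K r) =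
        S * γ - ∑ r ∈ Finset.range (N + 1), (-k) ^ r / (r.factorial : ℝ) * K r := by
      rw [hS, Finset.sum_mul, ← Finset.sum_sub_distrib]
      refine Finset.sum_congr rfl fun r _ => ?_
      rw [← neg_mul, mul_pow]; ring
    simp only [← mul_assoc]
    rw [← Finset.sum_mul, h3, h4]
    ring
  rw [heq]
  refine (abs_add_le _ _).trans ?_
  rw [abs_mul, abs_mul e₀, abs_mul, abs_of_pos (Real.exp_pos _), add_mul]
  refine add_le_add (h1.trans ?_) (h2.trans ?_)
  -- The exponential remainder is the extra term `r = N + 1` of the majorant.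
  · refine mul_le_mul_of_nonneg_left ?_ (by positivity)
    exact Finset.single_le_sum (f := fun r => k ^ r * (ρ ^ (r * ν + N + 1) * e₁))
      (fun r _ => by positivity) (Finset.self_mem_range_succ (N + 1))
  · refine mul_le_mul_of_nonneg_left ?_ hM
    rw [Finset.sum_range_succ _ (N + 1)]
    exact le_add_of_nonneg_right (by positivity)

/-! ### The main terms, integrated over the whole space. -/

/-- The terms of degree `r` in `f` and of relative order at most `N` in the product of the Taylor
expansions of `g` and of `(f - f₀ ‖x‖ ^ ν) ^ r`. -/
noncomputable def truncatedProduct {d : ℕ} (f g : EuclideanSpace ℝ (Fin d) → ℝ) (ν N r : ℕ)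
    (x : EuclideanSpace ℝ (Fin d)) : ℝ :=
  ∑ j ∈ Finset.range (N + 1), ∑ m ∈ Finset.range (j + 1), expansionTerm f g ν (j - m) m r x

/-- For `‖x‖ ≥ δ` a lower power of `‖x‖` is bounded by a higher one. The main terms outside the ball
thus fit under the majorant of the local error, and no separate tail estimate is needed for them. -/
lemma exists_abs_truncatedProduct_le {d : ℕ} (f g : EuclideanSpace ℝ (Fin d) → ℝ) (ν N r : ℕ)
    {δ : ℝ} (hδ : 0 < δ) :
    ∃ C, 0 ≤ C ∧ ∀ x, δ ≤ ‖x‖ → |truncatedProduct f g ν N r x| ≤ C * ‖x‖ ^ (r * ν + N + 1) := by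
  choose C hC0 hC using fun j m => exists_abs_expansionTerm_le f g ν (j - m) m r
  refine ⟨∑ j ∈ Finset.range (N + 1), ∑ m ∈ Finset.range (j + 1), C j m * (δ ^ (N + 1 - j))⁻¹,
    Finset.sum_nonneg fun _ _ => Finset.sum_nonneg fun _ _ => mul_nonneg (hC0 _ _) (by positivity),
    fun x hx => ?_⟩
  rw [truncatedProduct]
  simp only [Finset.sum_mul]
  refine (Finset.abs_sum_le_sum_abs _ _).trans (Finset.sum_le_sum fun j hj => ?_)
  refine (Finset.abs_sum_le_sum_abs _ _).trans (Finset.sum_le_sum fun m hm => ?_)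
  refine (hC j m x).trans ?_
  rw [Finset.mem_range] at hj hm
  rw [mul_assoc]
  refine mul_le_mul_of_nonneg_left ?_ (hC0 _ _)
  rw [← div_eq_inv_mul, le_div_iff₀ (by positivity)]
  calc ‖x‖ ^ (j - m + m + r * ν) * δ ^ (N + 1 - j)
      ≤ ‖x‖ ^ (j - m + m + r * ν) * ‖x‖ ^ (N + 1 - j) := by gcongr
    _ = _ := by rw [← pow_add]; congr 1; omega

lemma integrable_truncatedProduct_mul_exp {d : ℕ} (hd : 1 ≤ d)
    (f g : EuclideanSpace ℝ (Fin d) → ℝ) {ν : ℕ} (hν : 1 ≤ ν) (N r : ℕ) {b : ℝ} (hb : 0 < b) :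
    Integrable fun x => truncatedProduct f g ν N r x * Real.exp (-(b * ‖x‖ ^ ν)) := by
  simp only [truncatedProduct, Finset.sum_mul]
  exact integrable_finsetSum _ fun j _ => integrable_finsetSum _ fun m _ =>
    integrable_expansionTerm_mul_exp hd f g hν _ _ _ hb

lemma integral_sum_truncatedProduct_mul_exp {d : ℕ} (hd : 1 ≤ d)
    (f g : EuclideanSpace ℝ (Fin d) → ℝ) {ν : ℕ} (hν : 1 ≤ ν) (N : ℕ) {f₀ k : ℝ} (hf₀ : 0 < f₀)
    (hk : 0 < k) :
    ∫ x, ∑ r ∈ Finset.range (N + 1), (-k) ^ r / (r.factorial : ℝ) *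
        (truncatedProduct f g ν N r x * Real.exp (-(k * f₀ * ‖x‖ ^ ν))) =
      k ^ (-((d : ℝ) / ν)) *
        ∑ j ∈ Finset.range (N + 1), zeta f g ν f₀ j * k ^ (-((j : ℝ) / ν)) := by
  have hb : 0 < k * f₀ := mul_pos hk hf₀
  have hi := fun j m r => integrable_expansionTerm_mul_exp hd f g hν (j - m) m r hb
  rw [integral_finsetSum _ fun r _ =>
    (integrable_truncatedProduct_mul_exp hd f g hν N r hb).const_mul _, Finset.mul_sum,
    ← Finset.sum_congr rfl fun j hj => sum_innerSum_eq_zeta hd f g hν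
      (Nat.lt_succ_iff.1 (Finset.mem_range.1 hj)) hf₀ hk]
  simp only [integral_const_mul, truncatedProduct, Finset.sum_mul]
  rw [Finset.sum_congr rfl fun r _ => congrArg _ (integral_finsetSum _ fun j _ =>
    integrable_finsetSum _ fun m _ => hi j m r)]
  simp only [Finset.mul_sum]
  rw [Finset.sum_comm]
  refine Finset.sum_congr rfl fun j _ => ?_
  rw [Finset.sum_comm]
  refine Finset.sum_congr rfl fun r _ => ?_
  rw [integral_finsetSum _ fun m _ => hi j m r, Finset.mul_sum]
  refine Finset.sum_congr rfl fun m _ => ?_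
  rw [integral_expansionTerm_mul_exp hd f g hν _ _ _ hb]

lemma sum_Icc_taylorPart {d : ℕ} (u : EuclideanSpace ℝ (Fin d) → ℝ) (N ν : ℕ)
    (x : EuclideanSpace ℝ (Fin d)) :
    ∑ n ∈ Finset.Icc ν (N + ν), taylorPart u n x =
      taylorPart u ν x + ∑ n ∈ Finset.Icc 1 N, taylorPart u (n + ν) x := by
  rw [← Finset.Ico_add_one_right_eq_Icc, ← Finset.Ico_add_one_right_eq_Icc,
    Finset.sum_eq_sum_Ico_succ_bot (by omega),
    Finset.sum_Ico_add' (fun n => taylorPart u n x) 1 (N + 1) ν, add_comm 1 ν,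
    add_right_comm N 1 ν]

/-! ### Local bounds, decay away from the origin and assembly. -/

/-- Uniform form, near the origin, of the expansions entering Laplace's method. -/
lemma exists_eventually_expansion_bounds {d : ℕ} {f g : EuclideanSpace ℝ (Fin d) → ℝ} {N ν : ℕ}
    (hν : 1 ≤ ν) (hfT : HasTaylorExpansion f ν (N + ν)) (hgT : HasTaylorExpansion g 0 N)
    {f₀ : ℝ} (hconst : ∀ Ω ∈ Metric.sphere (0 : EuclideanSpace ℝ (Fin d)) 1,
      taylorPart f ν Ω = f₀) :
    ∃ M, 0 ≤ M ∧ ∀ᶠ x in 𝓝 (0 : EuclideanSpace ℝ (Fin d)),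
      |f x - f₀ * ‖x‖ ^ ν| ≤ M * ‖x‖ ^ (ν + 1) ∧ |g x| ≤ M ∧
      ∀ r ∈ Finset.range (N + 1), |(f x - f₀ * ‖x‖ ^ ν) ^ r * g x - truncatedProduct f g ν N r x| ≤
        M * ‖x‖ ^ (r * ν + N + 1) := by
  have hP : ∀ n, taylorPart f (n + ν) =O[𝓝 0] fun x => ‖x‖ ^ (n + ν) :=
    fun n => taylorPart_isBigO f _
  have hG : ∀ l, taylorPart g l =O[𝓝 0] fun x => ‖x‖ ^ l := taylorPart_isBigO g
  have hF : (fun x => (f x - f₀ * ‖x‖ ^ ν) - ∑ n ∈ Finset.Icc 1 N, taylorPart f (n + ν) x) =O[𝓝 0]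
      fun x => ‖x‖ ^ (N + ν + 1) := by
    refine hfT.congr_left fun x => ?_
    rw [sum_Icc_taylorPart, taylorPart_eq_mul_norm_pow hν hconst]
    ring
  have hg : (fun x => g x - ∑ l ∈ Finset.range (N + 1), taylorPart g l x) =O[𝓝 0]
      fun x => ‖x‖ ^ (N + 1) := by
    refine hgT.congr_left fun x => ?_
    rw [← Finset.Ico_add_one_right_eq_Icc, Finset.range_eq_Ico]
  have h1 : (fun x => f x - f₀ * ‖x‖ ^ ν) =O[𝓝 0] fun x => ‖x‖ ^ (ν + 1) := by
    have hs : (fun x => ∑ n ∈ Finset.Icc 1 N, taylorPart f (n + ν) x) =O[𝓝 0]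
        fun x => ‖x‖ ^ (ν + 1) := IsBigO.fun_sum fun n hn =>
      (hP n).trans (isBigO_norm_pow_of_le (by rw [Finset.mem_Icc] at hn; omega))
    simpa using (hF.trans (isBigO_norm_pow_of_le (by omega))).add hs
  have h2 : g =O[𝓝 0] fun x => ‖x‖ ^ 0 := by
    have hs : (fun x => ∑ l ∈ Finset.range (N + 1), taylorPart g l x) =O[𝓝 0]
        fun x => ‖x‖ ^ 0 := IsBigO.fun_sum fun l _ =>
      (hG l).trans (isBigO_norm_pow_of_le (Nat.zero_le _))
    simpa using (hg.trans (isBigO_norm_pow_of_le (Nat.zero_le _))).add hs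
  have h3 := fun r => pow_mul_isBigO_expansion (ν := ν) (P := fun n => taylorPart f (n + ν))
    hP hG hF hg r
  obtain ⟨c₁, hc₁, h1⟩ := h1.exists_nonneg
  obtain ⟨c₂, hc₂, h2⟩ := h2.exists_nonneg
  choose c₃ hc₃ h3 using fun r => (h3 r).exists_nonneg
  have hc : 0 ≤ ∑ r ∈ Finset.range (N + 1), c₃ r := Finset.sum_nonneg fun r _ => hc₃ r
  refine ⟨c₁ + c₂ + ∑ r ∈ Finset.range (N + 1), c₃ r, by positivity, ?_⟩
  have h3' := (Filter.eventually_all_finset (Finset.range (N + 1))).2 fun r _ => (h3 r).bound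
  filter_upwards [h1.bound, h2.bound, h3'] with x hx1 hx2 hx3
  refine ⟨?_, ?_, fun r hr => ?_⟩
  · rw [Real.norm_eq_abs, norm_pow, norm_norm] at hx1
    exact hx1.trans (mul_le_mul_of_nonneg_right (by linarith) (by positivity))
  · rw [Real.norm_eq_abs, pow_zero, norm_one, mul_one] at hx2
    linarith
  · have hx := hx3 r hr
    rw [Real.norm_eq_abs, norm_pow, norm_norm] at hx
    refine hx.trans (mul_le_mul_of_nonneg_right ?_ (by positivity))
    have := Finset.single_le_sum (f := c₃) (fun r _ => hc₃ r) hr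
    linarith

/-- Used with `A = 0` for integrability at every `k ≥ k₀`, and with `A > 0` for exponential decay
away from the origin. -/
lemma abs_exp_neg_mul_le {k₀ k A t y : ℝ} (hk : k₀ ≤ k) (hA : A ≤ t) :
    |Real.exp (-(k * t)) * y| ≤ Real.exp (-(k - k₀) * A) * |Real.exp (-(k₀ * t)) * y| := by
  rw [abs_mul, abs_mul, Real.abs_exp, Real.abs_exp, ← mul_assoc, ← Real.exp_add]
  refine mul_le_mul_of_nonneg_right (Real.exp_le_exp.2 ?_) (abs_nonneg _)
  nlinarith [mul_le_mul_of_nonneg_left hA (sub_nonneg.2 hk)]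

lemma integrableOn_exp_neg_mul {X : Type*} [MeasurableSpace X] {μ : Measure X} {R : Set X}
    (hR : NullMeasurableSet R μ) {f g : X → ℝ} (hf : AEMeasurable f (μ.restrict R))
    (hg : AEMeasurable g (μ.restrict R)) (hf0 : ∀ x ∈ R, 0 ≤ f x) {k₀ k : ℝ} (hk : k₀ ≤ k)
    (hint : IntegrableOn (fun x => Real.exp (-(k₀ * f x)) * g x) R μ) :
    IntegrableOn (fun x => Real.exp (-(k * f x)) * g x) R μ := by
  refine hint.norm.mono' ?_ ?_
  · exact (((hf.const_mul k).neg.exp).mul hg).aestronglyMeasurable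
  · filter_upwards [ae_restrict_mem₀ hR] with x hx
    simpa using abs_exp_neg_mul_le (y := g x) hk (hf0 x hx)

lemma setIntegral_exp_neg_mul_isBigO {X : Type*} [MeasurableSpace X] {μ : Measure X} {S : Set X}
    (hS : NullMeasurableSet S μ) {f g : X → ℝ} {A : ℝ} (hA : 0 < A) (hfA : ∀ x ∈ S, A ≤ f x)
    {k₀ : ℝ} (hint : IntegrableOn (fun x => Real.exp (-(k₀ * f x)) * g x) S μ) (p : ℝ) :
    (fun k : ℝ => ∫ x in S, Real.exp (-(k * f x)) * g x ∂μ) =O[atTop] fun k : ℝ => k ^ p := by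
  refine IsBigO.trans ?_ (isLittleO_exp_neg_mul_rpow_atTop hA p).isBigO
  refine IsBigO.of_bound (Real.exp (k₀ * A) * ∫ x in S, |Real.exp (-(k₀ * f x)) * g x| ∂μ) ?_
  filter_upwards [eventually_ge_atTop k₀] with k hk
  have h := norm_integral_le_of_norm_le (hint.norm.const_mul (Real.exp (-(k - k₀) * A)))
    (f := fun x => Real.exp (-(k * f x)) * g x) (by
      filter_upwards [ae_restrict_mem₀ hS] with x hx
      exact abs_exp_neg_mul_le hk (hfA x hx))
  refine h.trans (le_of_eq ?_)
  rw [integral_const_mul, Real.norm_of_nonneg (Real.exp_pos _).le,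
    show -(k - k₀) * A = k₀ * A + -A * k by ring, Real.exp_add]
  simp only [Real.norm_eq_abs]
  ring

/-- Laplace's method on a small ball. -/
lemma exists_ball_setIntegral_bound {d : ℕ} (hd : 1 ≤ d) {R : Set (EuclideanSpace ℝ (Fin d))}
    (hR0 : R ∈ 𝓝 (0 : EuclideanSpace ℝ (Fin d)))
    {f g : EuclideanSpace ℝ (Fin d) → ℝ} {N ν : ℕ} (hν : 1 ≤ ν)
    (hfT : HasTaylorExpansion f ν (N + ν)) (hgT : HasTaylorExpansion g 0 N)
    {f₀ : ℝ} (hf₀ : 0 < f₀)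
    (hconst : ∀ Ω ∈ Metric.sphere (0 : EuclideanSpace ℝ (Fin d)) 1, taylorPart f ν Ω = f₀) :
    ∃ δ > 0, Metric.ball 0 δ ⊆ R ∧ ∃ C, ∀ k > 0,
      IntegrableOn (fun x => Real.exp (-(k * f x)) * g x) (Metric.ball 0 δ) →
      |(∫ x in Metric.ball 0 δ, Real.exp (-(k * f x)) * g x) - k ^ (-((d : ℝ) / ν)) *
          ∑ j ∈ Finset.range (N + 1), zeta f g ν f₀ j * k ^ (-((j : ℝ) / ν))| ≤
        C * k ^ (-(((N : ℝ) + d + 1) / ν)) := by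
  have hν' : (0 : ℝ) < ν := by exact_mod_cast hν
  obtain ⟨M, hM, hev⟩ := exists_eventually_expansion_bounds hν hfT hgT hconst
  have hsmall : ∀ᶠ x in 𝓝 (0 : EuclideanSpace ℝ (Fin d)), M * ‖x‖ < f₀ / 2 := by
    have hc : Continuous fun x : EuclideanSpace ℝ (Fin d) => M * ‖x‖ := by fun_prop
    exact hc.continuousAt.eventually_lt continuousAt_const (by simpa using hf₀)
  obtain ⟨δ, hδ, hball⟩ := Metric.eventually_nhds_iff_ball.1 ((hev.and hsmall).and hR0)
  refine ⟨δ, hδ, fun x hx => (hball x hx).2, ?_⟩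
  choose M₁ hM₁ hout using fun r => exists_abs_truncatedProduct_le f g ν N r hδ
  choose I hI using fun r : ℕ => integral_norm_pow_mul_exp hd (r * ν + N + 1) hν
  set C₁ := ∑ r ∈ Finset.range (N + 1), M₁ r with hC₁
  have hC₁0 : 0 ≤ C₁ := Finset.sum_nonneg fun r _ => hM₁ r
  set C₂ := M ^ (N + 2) + M + C₁ with hC₂
  refine ⟨C₂ * ∑ r ∈ Finset.range (N + 2),
    I r * (f₀ / 2) ^ (-((((r * ν + N + 1 : ℕ) : ℝ) + d) / ν)), fun k hk hint => ?_⟩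
  set main : EuclideanSpace ℝ (Fin d) → ℝ := fun x => ∑ r ∈ Finset.range (N + 1),
    (-k) ^ r / (r.factorial : ℝ) *
      (truncatedProduct f g ν N r x * Real.exp (-(k * f₀ * ‖x‖ ^ ν))) with hmain
  set B : EuclideanSpace ℝ (Fin d) → ℝ := fun x => C₂ * ∑ r ∈ Finset.range (N + 2),
    k ^ r * (‖x‖ ^ (r * ν + N + 1) * Real.exp (-(k * (f₀ / 2) * ‖x‖ ^ ν))) with hB
  have hkf : 0 < k * (f₀ / 2) := by positivity
  have hBsum : ∀ x : EuclideanSpace ℝ (Fin d), 0 ≤ ∑ r ∈ Finset.range (N + 2),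
      k ^ r * (‖x‖ ^ (r * ν + N + 1) * Real.exp (-(k * (f₀ / 2) * ‖x‖ ^ ν))) :=
    fun x => Finset.sum_nonneg fun r _ => by positivity
  have hterm := fun r : ℕ => (integrable_norm_pow_mul_exp hd (r * ν + N + 1) hν hkf).const_mul (k ^ r)
  have hBint : Integrable B := (integrable_finsetSum _ fun r _ => hterm r).const_mul _
  have hmint : Integrable main := integrable_finsetSum _ fun r _ =>
    (integrable_truncatedProduct_mul_exp hd f g hν N r (mul_pos hk hf₀)).const_mul _
  -- Inside the ball this is the expansion error; outside, where the indicator vanishes, it is the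
  -- size of the main terms.
  have hpt : ∀ x, ‖(Metric.ball 0 δ).indicator (fun x => Real.exp (-(k * f x)) * g x) x - main x‖ ≤
      B x := by
    intro x
    rw [Real.norm_eq_abs]
    by_cases hx : x ∈ Metric.ball (0 : EuclideanSpace ℝ (Fin d)) δ
    · rw [Set.indicator_of_mem hx]
      obtain ⟨⟨⟨h1, h2, h3⟩, h4⟩, -⟩ := hball x hx
      have h := abs_exp_mul_sub_sum_le hk.le (norm_nonneg x) hM h1 h4.le h2 h3
      rw [add_sub_cancel] at h
      exact h.trans (mul_le_mul_of_nonneg_right (by linarith) (hBsum x))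
    · rw [Set.indicator_of_notMem hx, zero_sub, abs_neg]
      rw [mem_ball_zero_iff, not_lt] at hx
      refine le_trans ?_ (mul_le_mul_of_nonneg_right
        (show C₁ ≤ C₂ by have := pow_nonneg hM (N + 2); linarith) (hBsum x))
      refine (Finset.abs_sum_le_sum_abs _ _).trans ?_
      rw [Finset.sum_range_succ _ (N + 1)]
      refine le_trans ?_ (mul_le_mul_of_nonneg_left (le_add_of_nonneg_right (by positivity)) hC₁0)
      rw [Finset.mul_sum]
      refine Finset.sum_le_sum fun r hr => ?_
      have hfac : |(-k) ^ r / (r.factorial : ℝ)| ≤ k ^ r :=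
        abs_neg_pow_div_factorial_le hk.le r
      have hexp : Real.exp (-(k * f₀ * ‖x‖ ^ ν)) ≤ Real.exp (-(k * (f₀ / 2) * ‖x‖ ^ ν)) := by
        refine Real.exp_le_exp.2 (neg_le_neg ?_)
        gcongr
        linarith
      have hle : M₁ r ≤ C₁ := Finset.single_le_sum (fun r _ => hM₁ r) hr
      rw [abs_mul, abs_mul, Real.abs_exp]
      calc _ ≤ k ^ r * ((M₁ r * ‖x‖ ^ (r * ν + N + 1)) *
            Real.exp (-(k * (f₀ / 2) * ‖x‖ ^ ν))) := by
            gcongr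
            · have := hM₁ r; positivity
            · exact hout r x hx
        _ ≤ k ^ r * ((C₁ * ‖x‖ ^ (r * ν + N + 1)) *
            Real.exp (-(k * (f₀ / 2) * ‖x‖ ^ ν))) := by gcongr
        _ = _ := by ring
  have hle := norm_integral_le_of_norm_le hBint (Eventually.of_forall hpt)
  have hind : Integrable ((Metric.ball 0 δ).indicator fun x => Real.exp (-(k * f x)) * g x) :=
    (integrable_indicator_iff measurableSet_ball).2 hint
  rw [integral_sub hind hmint, integral_indicator measurableSet_ball, hmain,
    integral_sum_truncatedProduct_mul_exp hd f g hν N hf₀ hk, Real.norm_eq_abs] at hle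
  refine hle.trans (le_of_eq ?_)
  rw [hB, integral_const_mul, integral_finsetSum _ fun r _ => hterm r, mul_assoc, Finset.sum_mul]
  congr 1
  refine Finset.sum_congr rfl fun r _ => ?_
  rw [integral_const_mul, hI r _ hkf, Real.mul_rpow hk.le (by positivity)]
  -- The factor `k ^ r` offsets the `rν` in the degree, so every term of the majorant integrates to
  -- the same power of `k`.
  have hpow : k ^ r * k ^ (-((((r * ν + N + 1 : ℕ) : ℝ) + d) / ν)) =
      k ^ (-(((N : ℝ) + d + 1) / ν)) := by
    rw [← Real.rpow_natCast, ← Real.rpow_add hk]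
    congr 1
    push_cast
    field_simp
    ring
  rw [← hpow]
  ring

end LaplaceTaylor

theorem corollary3p3 {d : ℕ} (hd : 1 ≤ d)
    -- a Lebesgue measurable set with the origin in its interior,
    -- and Lebesgue measurable functions on it
    (R : Set (EuclideanSpace ℝ (Fin d))) (hR : NullMeasurableSet R volume)
    (hR0 : (0 : EuclideanSpace ℝ (Fin d)) ∈ interior R)
    (f g : EuclideanSpace ℝ (Fin d) → ℝ)
    (hf : AEMeasurable f (volume.restrict R)) (hg : AEMeasurable g (volume.restrict R))
    -- `f` has its unique minimum `0` at the origin and is otherwise bounded away from zero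
    (hf0 : f 0 = 0) (hfpos : ∀ x ∈ R, x ≠ 0 → 0 < f x)
    (hfaway : ∀ δ > 0, ∃ A > 0, ∀ x ∈ R, δ ≤ ‖x‖ → A ≤ f x)
    -- `f` and `g` are given by Taylor series with remainder
    (N ν : ℕ) (hN : 1 ≤ N) (hν : 1 ≤ ν)
    (hfT : LaplaceTaylor.HasTaylorExpansion f ν (N + ν))
    (hgT : LaplaceTaylor.HasTaylorExpansion g 0 N)
    -- the leading coefficient of `f` is a positive constant on the unit sphere
    (f₀ : ℝ) (hf₀ : 0 < f₀)
    (hconst : ∀ Ω ∈ Metric.sphere (0 : EuclideanSpace ℝ (Fin d)) 1,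
      LaplaceTaylor.taylorPart f ν Ω = f₀)
    -- the integral converges for some `k₀ > 0`
    (k₀ : ℝ) (hk₀ : 0 < k₀)
    (hint : IntegrableOn (fun x => Real.exp (-(k₀ * f x)) * g x) R volume) :
    (∀ k ≥ k₀, IntegrableOn (fun x => Real.exp (-(k * f x)) * g x) R volume) ∧
    (fun k : ℝ => (∫ x in R, Real.exp (-(k * f x)) * g x) -
        k ^ (-((d : ℝ) / ν)) *
          ∑ j ∈ Finset.range (N + 1),
            LaplaceTaylor.zeta f g ν f₀ j * k ^ (-((j : ℝ) / ν)))
      =O[atTop] fun k : ℝ => k ^ (-(((N : ℝ) + d + 1) / ν)) := by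
  have hfnn : ∀ x ∈ R, 0 ≤ f x := fun x hx => by
    rcases eq_or_ne x 0 with rfl | h
    · exact hf0.ge
    · exact (hfpos x hx h).le
  have hintk : ∀ k ≥ k₀, IntegrableOn (fun x => Real.exp (-(k * f x)) * g x) R volume :=
    fun k hk => LaplaceTaylor.integrableOn_exp_neg_mul hR hf hg hfnn hk hint
  refine ⟨hintk, ?_⟩
  obtain ⟨δ, hδ, hδR, C, hC⟩ := LaplaceTaylor.exists_ball_setIntegral_bound hd
    (mem_interior_iff_mem_nhds.1 hR0) hν hfT hgT hf₀ hconst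
  -- The radius is fixed by the local expansion; only then is the lower bound of `f` outside the
  -- ball taken.
  obtain ⟨A, hA, hAf⟩ := hfaway δ hδ
  have hout := LaplaceTaylor.setIntegral_exp_neg_mul_isBigO
    (hR.diff measurableSet_ball.nullMeasurableSet) hA
    (fun x (hx : x ∈ R \ Metric.ball 0 δ) => hAf x hx.1 (by simpa using hx.2))
    (hint.mono_set Set.sdiff_subset) (-(((N : ℝ) + d + 1) / ν))
  have hin : (fun k : ℝ => (∫ x in Metric.ball 0 δ, Real.exp (-(k * f x)) * g x) -
      k ^ (-((d : ℝ) / ν)) * ∑ j ∈ Finset.range (N + 1),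
        LaplaceTaylor.zeta f g ν f₀ j * k ^ (-((j : ℝ) / ν)))
      =O[atTop] fun k : ℝ => k ^ (-(((N : ℝ) + d + 1) / ν)) := by
    refine IsBigO.of_bound C ?_
    filter_upwards [eventually_ge_atTop k₀] with k hk
    have hk0 : 0 < k := hk₀.trans_le hk
    rw [Real.norm_of_nonneg (Real.rpow_nonneg hk0.le _)]
    exact hC k hk0 ((hintk k hk).mono_set hδR)
  refine (hin.add hout).congr' ?_ EventuallyEq.rfl
  filter_upwards [eventually_ge_atTop k₀] with k hk
  rw [← integral_inter_add_sdiff measurableSet_ball (hintk k hk), Set.inter_eq_right.2 hδR]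
  ring
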